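/- Let $\varphi:[0,2\pi]\to\mathbb{R}$ be a strictly increasing, concave, continuous function with $\varphi(0)=0$ and $\varphi(2\pi)=1$ which is not linear (that is, $\varphi(t)\not\equiv t/(2\pi)$). For a measurable function $x:[0,2\pi]\to\mathbb{C}$ let $x^*(t)=\inf\{\tau\ge 0: m\{s\in[0,2\pi]:|x(s)|>\tau\}\le t\}$, $0<t\le 2\pi$ (where $m$ is Lebesgue measure), be the nonincreasing rearrangement of $|x|$, and let $\|x\|_{\Lambda(\varphi)}=\int_0^{2\pi}x^*(t)\,d\varphi(t)$ be the norm of the Lorentz space $\Lambda(\varphi)$ on $[0,2\pi]$. The Hardy–Lorentz space $H(\Lambda(\varphi))$ consists of all analytic functions $f$ on the unit disc $\mathbb{D}=\{z\in\mathbb{C}:|z|<1\}$ such that $\|f\|_{H(\Lambda(\varphi))}=\sup_{0\le r<1}\|f_r\|_{\Lambda(\varphi)}<\infty$, where $f_r(t)=f(re^{it})$. Call a bounded analytic function $f$ on $\mathbb{D}$ inner if for almost every $t\in[0,2\pi]$ its nontangential limit at $e^{it}$ has modulus $1$. Then every inner function is an extreme point of the closed unit ball $\{f\in H(\Lambda(\varphi)):\|f\|_{H(\Lambda(\varphi))}\le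 1\}$ of $H(\Lambda(\varphi))$. -/

import Mathlib

open Set MeasureTheory Filter Topology
open scoped ENNReal Complex.UnitDisc

noncomputable section

/-- The continuous nondecreasing function on the line which equals `φ` on `[0, 2π]` and is
constant on each of the two half-lines outside `[0, 2π]`. Its Stieltjes measure is the
measure `dφ` on `[0, 2π]`. -/
def lorentzStieltjes (φ : ℝ → ℝ) (hmono : MonotoneOn φ (Icc 0 (2 * Real.pi)))
    (hcont : ContinuousOn φ (Icc 0 (2 * Real.pi))) : StieltjesFunction ℝ where
  toFun := IccExtend Real.two_pi_pos.le ((Icc 0 (2 * Real.pi)).domRestrict φ)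
  mono' := Monotone.IccExtend _ (monotoneOn_iff_monotone.mp hmono)
  right_continuous' := fun _ =>
    (continuousOn_iff_continuous_domRestrict.mp hcont).Icc_extend'.continuousWithinAt

/-- The nonincreasing rearrangement of `|x|` for `x : [0, 2π] → ℂ`:
`x*(t) = inf {τ ≥ 0 : m {s ∈ [0, 2π] : |x(s)| > τ} ≤ t}`. -/
def rearrangement (x : ℝ → ℂ) (t : ℝ) : ℝ≥0∞ :=
  sInf {τ : ℝ≥0∞ | volume {s ∈ Icc (0 : ℝ) (2 * Real.pi) | τ < ‖x s‖ₑ} ≤ ENNReal.ofReal t}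

/-- The norm `∫_0^{2π} x*(t) dφ(t)` of the Lorentz space `Λ(φ)` on `[0, 2π]`, with values in
`[0, ∞]`. -/
def lorentzNorm (φ : ℝ → ℝ) (hmono : MonotoneOn φ (Icc 0 (2 * Real.pi)))
    (hcont : ContinuousOn φ (Icc 0 (2 * Real.pi))) (x : ℝ → ℂ) : ℝ≥0∞ :=
  ∫⁻ t in Ioc 0 (2 * Real.pi), rearrangement x t ∂(lorentzStieltjes φ hmono hcont).measure

open Classical in
/-- A function on the open unit disc, extended by `0` to the whole plane (only the values on
the disc are ever used). -/
def discExtend (f : 𝔻 → ℂ) (z : ℂ) : ℂ :=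
  if h : ‖z‖ < 1 then f (Complex.UnitDisc.mk z h) else 0

/-- `f` is analytic in the open unit disc. -/
def IsDiscAnalytic (f : 𝔻 → ℂ) : Prop :=
  DifferentiableOn ℂ (discExtend f) (Metric.ball 0 1)

/-- The norm `sup_{0 ≤ r < 1} ‖f_r‖_{Λ(φ)}`, where `f_r(t) = f(r e^{it})`, with values in
`[0, ∞]`. -/
def hardyLorentzNorm (φ : ℝ → ℝ) (hmono : MonotoneOn φ (Icc 0 (2 * Real.pi)))
    (hcont : ContinuousOn φ (Icc 0 (2 * Real.pi))) (f : 𝔻 → ℂ) : ℝ≥0∞ :=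
  ⨆ r ∈ Ico (0 : ℝ) 1, lorentzNorm φ hmono hcont
    (fun t => discExtend f ((r : ℂ) * Complex.exp ((t : ℂ) * Complex.I)))

/-- The Hardy–Lorentz space `H(Λ(φ))`. -/
def hardyLorentzSpace (φ : ℝ → ℝ) (hmono : MonotoneOn φ (Icc 0 (2 * Real.pi)))
    (hcont : ContinuousOn φ (Icc 0 (2 * Real.pi))) : Set (𝔻 → ℂ) :=
  {f | IsDiscAnalytic f ∧ hardyLorentzNorm φ hmono hcont f < ∞}

/-- The closed unit ball of the Hardy–Lorentz space `H(Λ(φ))`. -/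
def hardyLorentzBall (φ : ℝ → ℝ) (hmono : MonotoneOn φ (Icc 0 (2 * Real.pi)))
    (hcont : ContinuousOn φ (Icc 0 (2 * Real.pi))) : Set (𝔻 → ℂ) :=
  {f ∈ hardyLorentzSpace φ hmono hcont | hardyLorentzNorm φ hmono hcont f ≤ 1}

/-- `f(z) → w` as `z → ζ` nontangentially, i.e. within each of the approach regions
`{z ∈ 𝔻 : |z - ζ| < M (1 - |z|)}` at the point `ζ` of the unit circle. -/
def HasNontangentialLimit (f : 𝔻 → ℂ) (ζ w : ℂ) : Prop :=
  ∀ M : ℝ, Tendsto (discExtend f) (𝓝[{z : ℂ | ‖z‖ < 1 ∧ ‖z - ζ‖ < M * (1 - ‖z‖)}] ζ) (𝓝 w)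

/-- Inner functions: bounded analytic functions in the unit disc whose nontangential boundary
values have modulus `1` almost everywhere. -/
def IsInnerFunction (f : 𝔻 → ℂ) : Prop :=
  IsDiscAnalytic f ∧ (∃ C : ℝ, ∀ z : 𝔻, ‖f z‖ ≤ C) ∧
    ∀ᵐ t : ℝ ∂(volume.restrict (Icc (0 : ℝ) (2 * Real.pi))),
      ∃ w : ℂ, HasNontangentialLimit f (Complex.exp ((t : ℂ) * Complex.I)) w ∧ ‖w‖ = 1

end

/-!
Concavity gives `φ(s) ≥ s / 2π`, so the Lorentz norm of `x` dominates its normalised `L¹` norm.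
As `φ` is not linear, it even exceeds its chord by a positive multiple of the tent function
`min s (2π - s)` (`half_lt_of_concaveOn_of_not_linear`, `ConcaveOn.chord_add_tent_le`). Writing the
Lorentz norm as the integral of `φ` along the distribution function of `|x|`, and observing that
the tent function integrates along it to the `L¹` distance of `|x|` to its median, one finds that
a function in the Lorentz unit ball whose `L¹` mean is nearly `1` has modulus nearly `1` in `L¹`,
with a linear rate (`integral_norm_le_of_lorentzNorm_le_one`).

Let an inner `f` be a convex combination `a g + b h` of elements of the ball. Since `f` is bounded
with radial limits of modulus `1`, the means of `|f|` over circles of radius `r` tend to `1` as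
`r → 1`. By the triangle inequality the means of `|g|` and `|h|` then tend to `1` too, so `|g|` and
`|h|` tend to `1` in `L¹` of the circles. The disc is strictly convex, which forces `g - h` to tend
to `0` in `L¹` of the circles (`integral_norm_sub_le`), and Cauchy's formula gives `g = h`.
Everything takes place on circles inside the disc, so no boundary values of `g` and `h` are needed.

That `f` itself lies in the ball amounts to `|f| ≤ 1`, which follows from Cauchy's formula applied
to the powers of `f` (`IsInnerFunction.norm_discExtend_le_one`).
-/

/-! ### Concave functions above their chord -/

theorem ConcaveOn.mul_add_mul_le {φ : ℝ → ℝ} {S : Set ℝ} (hconc : ConcaveOn ℝ S φ) {x y a b : ℝ}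
    (hx : x ∈ S) (hy : y ∈ S) (ha : 0 ≤ a) (hb : 0 ≤ b) (hab : a + b = 1) :
    a * φ x + b * φ y ≤ φ (a * x + b * y) :=
  hconc.2 hx hy ha hb hab

/-- A concave function meeting its chord at one interior point coincides with it; here the point
is the midpoint `π`. -/
theorem half_lt_of_concaveOn_of_not_linear {φ : ℝ → ℝ}
    (hconc : ConcaveOn ℝ (Icc 0 (2 * Real.pi)) φ)
    (hzero : φ 0 = 0) (hone : φ (2 * Real.pi) = 1)
    (hnonlin : ¬ ∃ c : ℝ, ∀ t ∈ Icc (0 : ℝ) (2 * Real.pi), φ t = c * t) :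
    1 / 2 < φ Real.pi := by
  have hpi := Real.pi_pos
  by_contra! hle
  refine hnonlin ⟨1 / (2 * Real.pi), fun t ht => le_antisymm ?_ ?_⟩
  · rcases lt_trichotomy t Real.pi with h | h | h
    · have := hconc.mul_add_mul_le ht (right_mem_Icc.2 (by positivity))
        (a := Real.pi / (2 * Real.pi - t)) (b := (Real.pi - t) / (2 * Real.pi - t))
        (div_nonneg hpi.le (by linarith)) (div_nonneg (by linarith) (by linarith))
        (by rw [← add_div]; exact (div_eq_one_iff_eq (by linarith)).2 (by ring))
      have h0 : 0 < 2 * Real.pi - t := by linarith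
      have e : (Real.pi / (2 * Real.pi - t)) * t +
          ((Real.pi - t) / (2 * Real.pi - t)) * (2 * Real.pi) = Real.pi := by
        rw [div_mul_eq_mul_div, div_mul_eq_mul_div, ← add_div, div_eq_iff h0.ne']; ring
      rw [e, hone] at this
      have h2 := this.trans hle
      rw [div_mul_eq_mul_div, div_mul_eq_mul_div, ← add_div, div_le_iff₀ h0] at h2
      rw [one_div_mul_eq_div, le_div_iff₀ (by positivity)]
      linarith
    · subst h; refine hle.trans (le_of_eq ?_); field_simp
    · have := hconc.mul_add_mul_le (left_mem_Icc.2 (by positivity)) ht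
        (a := (t - Real.pi) / t) (b := Real.pi / t)
        (div_nonneg (by linarith) (by linarith)) (div_nonneg (by linarith) (by linarith))
        (by rw [← add_div]; exact (div_eq_one_iff_eq (by linarith)).2 (by ring))
      have h0 : 0 < t := by linarith
      have e : ((t - Real.pi) / t) * (0 : ℝ) + (Real.pi / t) * t = Real.pi := by
        field_simp; ring
      rw [e, hzero] at this
      have h2 := this.trans hle
      field_simp at h2 ⊢
      nlinarith
  · have := hconc.mul_add_mul_le (left_mem_Icc.2 (by positivity)) (right_mem_Icc.2 (by positivity))
      (a := 1 - t / (2 * Real.pi)) (b := t / (2 * Real.pi))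
      (sub_nonneg.2 ((div_le_one (by positivity)).2 ht.2)) (div_nonneg ht.1 (by positivity))
      (by ring)
    have e : (1 - t / (2 * Real.pi)) * (0 : ℝ) + (t / (2 * Real.pi)) * (2 * Real.pi) = t := by
      field_simp; ring
    rw [e, hzero, hone] at this
    calc _ = _ := by ring
      _ ≤ _ := this

/-- A concave `φ` on `[0, 2π]` exceeds its chord by at least a tent function with peak at `π`. -/
theorem ConcaveOn.chord_add_tent_le {φ : ℝ → ℝ}
    (hconc : ConcaveOn ℝ (Icc 0 (2 * Real.pi)) φ)
    (hzero : φ 0 = 0) (hone : φ (2 * Real.pi) = 1) {s : ℝ} (hs : s ∈ Icc 0 (2 * Real.pi)) :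
    1 / (2 * Real.pi) * s + (φ Real.pi - 1 / 2) / Real.pi * min s (2 * Real.pi - s) ≤ φ s := by
  have hpi := Real.pi_pos
  have hpm : Real.pi ∈ Icc 0 (2 * Real.pi) := ⟨hpi.le, by linarith⟩
  rcases le_total s Real.pi with h | h
  · rw [min_eq_left (by linarith)]
    have := hconc.mul_add_mul_le (left_mem_Icc.2 (by positivity)) hpm
      (a := 1 - s / Real.pi) (b := s / Real.pi)
      (sub_nonneg.2 ((div_le_one (by positivity)).2 h)) (div_nonneg hs.1 (by positivity))
      (by ring)
    have e : (1 - s / Real.pi) * (0 : ℝ) + (s / Real.pi) * Real.pi = s := by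
      field_simp; ring
    rw [e, hzero] at this
    refine le_trans (le_of_eq ?_) this
    field_simp; ring
  · rw [min_eq_right (by linarith)]
    have := hconc.mul_add_mul_le hpm (right_mem_Icc.2 (by positivity))
      (a := (2 * Real.pi - s) / Real.pi) (b := 1 - (2 * Real.pi - s) / Real.pi)
      (div_nonneg (by linarith [hs.2]) (by positivity))
      (sub_nonneg.2 ((div_le_one (by positivity)).2 (by linarith)))
      (by ring)
    have e : ((2 * Real.pi - s) / Real.pi) * Real.pi +
        (1 - (2 * Real.pi - s) / Real.pi) * (2 * Real.pi) = s := by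
      field_simp; ring
    rw [e, hone] at this
    refine le_trans (le_of_eq ?_) this
    field_simp; ring

/-! ### The Lorentz norm and the distribution function -/

/-- The measure `dφ` of an initial open interval. -/
theorem lorentzStieltjes_measure_Ioo {φ : ℝ → ℝ}
    (hmono : MonotoneOn φ (Icc 0 (2 * Real.pi))) (hcont : ContinuousOn φ (Icc 0 (2 * Real.pi)))
    (hzero : φ 0 = 0) {s : ℝ} (hs : s ∈ Icc 0 (2 * Real.pi)) :
    (lorentzStieltjes φ hmono hcont).measure (Ioo 0 s) = ENNReal.ofReal (φ s) := by
  have hc : Continuous (lorentzStieltjes φ hmono hcont) :=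
    (continuousOn_iff_continuous_domRestrict.mp hcont).Icc_extend'
  have hv : ∀ u ∈ Icc 0 (2 * Real.pi), lorentzStieltjes φ hmono hcont u = φ u := fun u hu =>
    IccExtend_of_mem Real.two_pi_pos.le ((Icc 0 (2 * Real.pi)).domRestrict φ) hu
  rw [StieltjesFunction.measure_Ioo, hc.continuousAt.continuousWithinAt.leftLim_eq,
    hv s hs, hv 0 (left_mem_Icc.2 Real.two_pi_pos.le), hzero, sub_zero]

theorem lorentzStieltjes_measure_Ioc {φ : ℝ → ℝ}
    (hmono : MonotoneOn φ (Icc 0 (2 * Real.pi))) (hcont : ContinuousOn φ (Icc 0 (2 * Real.pi)))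
    (hzero : φ 0 = 0) (hone : φ (2 * Real.pi) = 1) :
    (lorentzStieltjes φ hmono hcont).measure (Ioc 0 (2 * Real.pi)) = 1 := by
  have hv : ∀ u ∈ Icc 0 (2 * Real.pi), lorentzStieltjes φ hmono hcont u = φ u := fun u hu =>
    IccExtend_of_mem Real.two_pi_pos.le ((Icc 0 (2 * Real.pi)).domRestrict φ) hu
  rw [StieltjesFunction.measure_Ioc, hv _ (left_mem_Icc.2 Real.two_pi_pos.le),
    hv _ (right_mem_Icc.2 Real.two_pi_pos.le), hzero, hone]
  simp

theorem rearrangement_le {x : ℝ → ℂ} {B : ℝ} (hB : ∀ s, ‖x s‖ ≤ B) (t : ℝ) :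
    rearrangement x t ≤ ENNReal.ofReal B := by
  refine sInf_le ?_
  have : {s ∈ Icc (0 : ℝ) (2 * Real.pi) | ENNReal.ofReal B < ‖x s‖ₑ} = ∅ := by
    ext s
    simp only [mem_ofPred_eq, mem_empty_iff_false, iff_false, not_and, not_lt]
    intro _
    rw [← ofReal_norm]
    exact ENNReal.ofReal_le_ofReal (hB s)
  rw [mem_ofPred_eq, this, measure_empty]; exact zero_le

theorem lorentzNorm_le_one {φ : ℝ → ℝ}
    (hmono : MonotoneOn φ (Icc 0 (2 * Real.pi))) (hcont : ContinuousOn φ (Icc 0 (2 * Real.pi)))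
    (hzero : φ 0 = 0) (hone : φ (2 * Real.pi) = 1) {x : ℝ → ℂ} (hx : ∀ s, ‖x s‖ ≤ 1) :
    lorentzNorm φ hmono hcont x ≤ 1 := by
  have h : ∀ t, rearrangement x t ≤ 1 := fun t => by simpa using rearrangement_le hx t
  calc lorentzNorm φ hmono hcont x
      ≤ ∫⁻ _ in Ioc 0 (2 * Real.pi), 1 ∂(lorentzStieltjes φ hmono hcont).measure :=
        lintegral_mono h
    _ = 1 := by simp [lorentzStieltjes_measure_Ioc hmono hcont hzero hone]

/-- The distribution function `τ ↦ m {s ∈ (0, 2π] : τ ≤ |x(s)|}` of `|x|`, with values in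
`[0, 2π]`. The inequality is non-strict, which makes `ofReal_le_rearrangement` immediate; this
affects only countably many `τ`. -/
noncomputable def distribution (x : ℝ → ℂ) (τ : ℝ) : ℝ :=
  (volume.restrict (Ioc 0 (2 * Real.pi))).real {s | τ ≤ ‖x s‖}

theorem distribution_antitone (x : ℝ → ℂ) : Antitone (distribution x) := fun _ _ h =>
  measureReal_mono fun _ hs => h.trans hs

theorem distribution_mem_Icc (x : ℝ → ℂ) (τ : ℝ) :
    distribution x τ ∈ Icc 0 (2 * Real.pi) := by
  refine ⟨measureReal_nonneg, (measureReal_mono (subset_univ _)).trans (le_of_eq ?_)⟩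
  simp [Real.pi_pos.le]

theorem rearrangement_antitone (x : ℝ → ℂ) : Antitone (rearrangement x) := fun _ _ h =>
  sInf_le_sInf fun _ hτ => le_trans hτ (ENNReal.ofReal_le_ofReal h)

theorem ofReal_le_rearrangement {x : ℝ → ℂ} {t τ : ℝ} (ht : 0 ≤ t)
    (h : t < distribution x τ) : ENNReal.ofReal τ ≤ rearrangement x t := by
  refine le_sInf fun σ hσ => ?_
  by_contra! hlt
  refine h.not_ge ?_
  have : (volume.restrict (Ioc 0 (2 * Real.pi))) {s | τ ≤ ‖x s‖} ≤ ENNReal.ofReal t := by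
    refine le_trans ?_ hσ
    rw [Measure.restrict_apply' measurableSet_Ioc]
    refine measure_mono fun s hs => ⟨Ioc_subset_Icc_self hs.2, hlt.trans_le ?_⟩
    rw [← ofReal_norm]
    exact ENNReal.ofReal_le_ofReal hs.1
  exact ENNReal.toReal_le_of_le_ofReal ht this

/-- Layer-cake bound: the Lorentz norm dominates the integral of `φ` composed with the
distribution function. -/
theorem ofReal_integral_distribution_le_lorentzNorm {φ : ℝ → ℝ}
    (hmono : MonotoneOn φ (Icc 0 (2 * Real.pi))) (hcont : ContinuousOn φ (Icc 0 (2 * Real.pi)))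
    (hzero : φ 0 = 0) {x : ℝ → ℂ} {B : ℝ} (hB : ∀ s, ‖x s‖ ≤ B) :
    ENNReal.ofReal (∫ τ in Ioc 0 B, φ (distribution x τ)) ≤ lorentzNorm φ hmono hcont x := by
  set μ := (lorentzStieltjes φ hmono hcont).measure.restrict (Ioc 0 (2 * Real.pi)) with hμ
  have hfin : ∀ t, rearrangement x t ≠ ∞ := fun t =>
    ((rearrangement_le hB t).trans_lt ENNReal.ofReal_lt_top).ne
  have hanti : Antitone fun t => (rearrangement x t).toReal := fun a b h =>
    ENNReal.toReal_mono (hfin a) (rearrangement_antitone x h)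
  have e : lorentzNorm φ hmono hcont x = ∫⁻ τ in Ioi 0, μ {t | τ ≤ (rearrangement x t).toReal} := by
    rw [← lintegral_eq_lintegral_meas_le μ (ae_of_all _ fun t => ENNReal.toReal_nonneg)
      hanti.measurable.aemeasurable]
    exact lintegral_congr fun t => (ENNReal.ofReal_toReal (hfin t)).symm
  have hφ0 : ∀ τ, 0 ≤ φ (distribution x τ) := fun τ => by
    rw [← hzero]
    exact hmono (left_mem_Icc.2 Real.two_pi_pos.le) (distribution_mem_Icc x τ)
      (distribution_mem_Icc x τ).1
  rw [e]
  calc ENNReal.ofReal (∫ τ in Ioc 0 B, φ (distribution x τ))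
      ≤ ∫⁻ τ in Ioc 0 B, ENNReal.ofReal (φ (distribution x τ)) := by
        rw [ofReal_integral_eq_lintegral_ofReal _ (ae_of_all _ hφ0)]
        have : Antitone fun τ => φ (distribution x τ) := fun a b h =>
          hmono (distribution_mem_Icc x b) (distribution_mem_Icc x a) (distribution_antitone x h)
        exact (this.antitoneOn _).integrableOn_isCompact isCompact_Icc |>.mono_set
          Ioc_subset_Icc_self
    _ ≤ ∫⁻ τ in Ioi 0, ENNReal.ofReal (φ (distribution x τ)) :=
        lintegral_mono_set Ioc_subset_Ioi_self
    _ ≤ _ := by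
        refine setLIntegral_mono' measurableSet_Ioi fun τ hτ => ?_
        rw [← lorentzStieltjes_measure_Ioo hmono hcont hzero (distribution_mem_Icc x τ),
          hμ, Measure.restrict_apply' measurableSet_Ioc]
        refine measure_mono fun t ht => ⟨?_, ht.1, ht.2.le.trans (distribution_mem_Icc x τ).2⟩
        exact (ENNReal.ofReal_le_iff_le_toReal (hfin t)).1 (ofReal_le_rearrangement ht.1.le ht.2)

/-- Layer-cake formula for the truncation of `|x|` at height `m`. -/
theorem integral_distribution {x : ℝ → ℂ} (hx : Continuous x) {m : ℝ} (hm : 0 ≤ m) :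
    ∫ τ in Ioc 0 m, distribution x τ = ∫ s in Ioc 0 (2 * Real.pi), min ‖x s‖ m := by
  have hint : Integrable (fun s => min ‖x s‖ m) (volume.restrict (Ioc 0 (2 * Real.pi))) :=
    ((hx.norm.min continuous_const).integrableOn_Icc).mono_set Ioc_subset_Icc_self
  rw [hint.integral_eq_integral_Ioc_meas_le (M := m)
    (ae_of_all _ fun s => le_min (norm_nonneg _) hm) (ae_of_all _ fun s => min_le_right _ _)]
  refine setIntegral_congr_fun measurableSet_Ioc fun τ hτ => ?_
  simp only [distribution, le_min_iff, hτ.2, and_true]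

/-- A median `m` of `|x|`: the distribution function is at least `π` below `m` and at most `π`
above `m`. -/
theorem exists_median (x : ℝ → ℂ) {B : ℝ} (hB : ∀ s, ‖x s‖ ≤ B) :
    ∃ m, 0 ≤ m ∧ m ≤ B ∧ (∀ τ, τ < m → Real.pi ≤ distribution x τ) ∧
      ∀ τ, m < τ → τ ≤ B → distribution x τ ≤ Real.pi := by
  have hB0 : 0 ≤ B := (norm_nonneg _).trans (hB 0)
  set S := {τ : ℝ | 0 ≤ τ ∧ τ ≤ B ∧ Real.pi ≤ distribution x τ} with hS
  have h0 : (0 : ℝ) ∈ S := by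
    refine ⟨le_rfl, hB0, ?_⟩
    simp [distribution, Real.pi_pos.le]
    linarith [Real.pi_pos]
  have hbd : BddAbove S := ⟨B, fun τ h => h.2.1⟩
  refine ⟨sSup S, le_csSup hbd h0, csSup_le ⟨0, h0⟩ fun τ h => h.2.1, fun τ hτ => ?_,
    fun τ hτ hτB => ?_⟩
  · obtain ⟨σ, hσ, hlt⟩ := exists_lt_of_lt_csSup ⟨0, h0⟩ hτ
    exact hσ.2.2.trans (distribution_antitone x hlt.le)
  · by_contra! h
    exact hτ.not_ge (le_csSup hbd ⟨(le_csSup hbd h0).trans hτ.le, hτB, h.le⟩)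

/-- Quantitative form of the fact that the Lorentz norm exceeds the normalised `L¹` norm unless
`|x|` is constant: the excess controls the `L¹` distance of `|x|` to a constant (its median). -/
theorem exists_integral_abs_sub_le {φ : ℝ → ℝ}
    (hmono : MonotoneOn φ (Icc 0 (2 * Real.pi)))
    (hconc : ConcaveOn ℝ (Icc 0 (2 * Real.pi)) φ)
    (hcont : ContinuousOn φ (Icc 0 (2 * Real.pi)))
    (hzero : φ 0 = 0) (hone : φ (2 * Real.pi) = 1)
    {x : ℝ → ℂ} (hx : Continuous x) {B : ℝ} (hB : ∀ s, ‖x s‖ ≤ B)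
    (hx1 : lorentzNorm φ hmono hcont x ≤ 1) :
    ∃ m : ℝ, 1 / (2 * Real.pi) * (∫ s in Ioc 0 (2 * Real.pi), ‖x s‖) +
      (φ Real.pi - 1 / 2) / Real.pi * (∫ s in Ioc 0 (2 * Real.pi), |‖x s‖ - m|) ≤ 1 := by
  obtain ⟨m, hm0, hmB, hlo, hhi⟩ := exists_median x hB
  have hB0 : 0 ≤ B := (norm_nonneg _).trans (hB 0)
  refine ⟨m, ?_⟩
  set c := (φ Real.pi - 1 / 2) / Real.pi
  have hle : (∫ τ in Ioc 0 B, φ (distribution x τ)) ≤ 1 :=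
    ENNReal.ofReal_le_one.1
      ((ofReal_integral_distribution_le_lorentzNorm hmono hcont hzero hB).trans hx1)
  refine le_trans ?_ hle
  have hiφ : IntegrableOn (fun τ => φ (distribution x τ)) (Ioc 0 B) := by
    have : Antitone fun τ => φ (distribution x τ) := fun a b h =>
      hmono (distribution_mem_Icc x b) (distribution_mem_Icc x a) (distribution_antitone x h)
    exact (this.antitoneOn _).integrableOn_isCompact isCompact_Icc |>.mono_set Ioc_subset_Icc_self
  have hid : ∀ M, IntegrableOn (distribution x) (Ioc 0 M) := fun M =>
    ((distribution_antitone x).antitoneOn _).integrableOn_isCompact isCompact_Icc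
      |>.mono_set Ioc_subset_Icc_self
  have hii : IntegrableOn ((Iic m).indicator fun τ => 2 * Real.pi - 2 * distribution x τ)
      (Ioc 0 B) :=
    ((integrable_const _).sub ((hid B).const_mul 2)).indicator measurableSet_Iic
  -- the right-hand integrand is `λ / 2π + c * min λ (2π - λ)` with `λ` the distribution function
  have key : ∫ τ in Ioc 0 B, ((1 / (2 * Real.pi) + c) * distribution x τ +
      c * (Iic m).indicator (fun τ => 2 * Real.pi - 2 * distribution x τ) τ) ≤
      ∫ τ in Ioc 0 B, φ (distribution x τ) := by
    refine integral_mono_ae (((hid B).const_mul _).add (hii.const_mul _)) hiφ ?_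
    have hne : ∀ᵐ τ ∂(volume.restrict (Ioc 0 B)), τ ≠ m :=
      ae_restrict_of_ae (Measure.ae_ne volume m)
    filter_upwards [ae_restrict_mem measurableSet_Ioc, hne] with τ hτ hτm
    refine le_trans (le_of_eq ?_)
      (hconc.chord_add_tent_le hzero hone (distribution_mem_Icc x τ))
    rcases lt_or_gt_of_ne hτm with h | h
    · have := hlo τ h
      rw [indicator_of_mem (show τ ∈ Iic m from h.le), min_eq_right (by linarith)]
      ring
    · have := hhi τ h hτ.2
      rw [indicator_of_notMem (show τ ∉ Iic m from h.not_ge), min_eq_left (by linarith)]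
      ring
  refine le_trans (le_of_eq ?_) key
  -- both sides are now explicit: the truncated layer-cake formula at heights `B` and `m` turns the
  -- tent part into `∫ |x| + 2πm - 2 ∫ min |x| m = ∫ ||x| - m|`
  have hset : Ioc 0 B ∩ Iic m = Ioc 0 m := by
    ext τ; simp only [mem_inter_iff, mem_Ioc, mem_Iic]
    exact ⟨fun h => ⟨h.1.1, h.2⟩, fun h => ⟨⟨h.1, h.2.trans hmB⟩, h.2⟩⟩
  have hnorm : IntegrableOn (fun s => ‖x s‖) (Ioc 0 (2 * Real.pi)) :=
    hx.norm.integrableOn_Icc.mono_set Ioc_subset_Icc_self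
  have hmin : IntegrableOn (fun s => min ‖x s‖ m) (Ioc 0 (2 * Real.pi)) :=
    (hx.norm.min continuous_const).integrableOn_Icc.mono_set Ioc_subset_Icc_self
  have habs : ∫ s in Ioc 0 (2 * Real.pi), |‖x s‖ - m| =
      (∫ s in Ioc 0 (2 * Real.pi), ‖x s‖) + 2 * Real.pi * m -
        2 * ∫ s in Ioc 0 (2 * Real.pi), min ‖x s‖ m := by
    have : ∀ s, |‖x s‖ - m| = ‖x s‖ + m - 2 * min ‖x s‖ m := fun s => by
      rcases le_total ‖x s‖ m with h | h
      · rw [min_eq_left h, abs_of_nonpos (by linarith)]; ring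
      · rw [min_eq_right h, abs_of_nonneg (by linarith)]; ring
    simp_rw [this]
    have hadd : IntegrableOn (fun s => ‖x s‖ + m) (Ioc 0 (2 * Real.pi)) :=
      hnorm.add (integrable_const _)
    rw [integral_sub hadd (hmin.const_mul 2),
      integral_add hnorm (integrable_const _), integral_const_mul]
    simp [Real.pi_pos.le]
  have hfull := integral_distribution hx hB0
  simp_rw [min_eq_left (hB _)] at hfull
  rw [integral_add ((hid B).const_mul _) (hii.const_mul _), integral_const_mul, integral_const_mul,
    setIntegral_indicator measurableSet_Iic, hset, integral_sub (integrable_const _)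
      ((hid m).const_mul 2), integral_const_mul 2 (distribution x), integral_distribution hx hm0, hfull, habs]
  simp [hm0]
  ring

/-- In the Lorentz unit ball, the defect `2π - ∫ |x|` is nonnegative and controls the `L¹` distance
of `|x|` to the constant `1`: the median of `exists_integral_abs_sub_le` is itself close to the
mean. -/
theorem integral_norm_le_of_lorentzNorm_le_one {φ : ℝ → ℝ}
    (hmono : MonotoneOn φ (Icc 0 (2 * Real.pi)))
    (hconc : ConcaveOn ℝ (Icc 0 (2 * Real.pi)) φ)
    (hcont : ContinuousOn φ (Icc 0 (2 * Real.pi)))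
    (hzero : φ 0 = 0) (hone : φ (2 * Real.pi) = 1) (hc : 1 / 2 < φ Real.pi)
    {x : ℝ → ℂ} (hx : Continuous x) {B : ℝ} (hB : ∀ s, ‖x s‖ ≤ B)
    (hx1 : lorentzNorm φ hmono hcont x ≤ 1) :
    (∫ s in Ioc 0 (2 * Real.pi), ‖x s‖) ≤ 2 * Real.pi ∧
    (∫ s in Ioc 0 (2 * Real.pi), |‖x s‖ - 1|) ≤
      (1 / (φ Real.pi - 1 / 2) + 1) * (2 * Real.pi - ∫ s in Ioc 0 (2 * Real.pi), ‖x s‖) := by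
  obtain ⟨m, hm⟩ := exists_integral_abs_sub_le hmono hconc hcont hzero hone hx hB hx1
  have hpi := Real.pi_pos
  set c := φ Real.pi - 1 / 2
  have hc0 : 0 < c := by simp only [c]; linarith
  set I := ∫ s in Ioc 0 (2 * Real.pi), ‖x s‖ with hI
  set J := ∫ s in Ioc 0 (2 * Real.pi), |‖x s‖ - m| with hJ
  have hJ0 : 0 ≤ J := integral_nonneg fun _ => abs_nonneg _
  have hnorm : IntegrableOn (fun s => ‖x s‖) (Ioc 0 (2 * Real.pi)) :=
    hx.norm.integrableOn_Icc.mono_set Ioc_subset_Icc_self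
  have hsub : IntegrableOn (fun s => ‖x s‖ - m) (Ioc 0 (2 * Real.pi)) :=
    hnorm.sub (integrable_const _)
  have hcJ : 2 * c * J ≤ 2 * Real.pi - I := by
    field_simp at hm
    linarith
  have hIle : I ≤ 2 * Real.pi := by nlinarith [mul_nonneg hc0.le hJ0]
  have hJle : 2 * J ≤ 1 / c * (2 * Real.pi - I) := by
    rw [one_div, inv_mul_eq_div, le_div_iff₀ hc0]; linarith
  have hIm : |I - 2 * Real.pi * m| ≤ J := by
    have : ∫ s in Ioc 0 (2 * Real.pi), (‖x s‖ - m) = I - 2 * Real.pi * m := by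
      rw [integral_sub hnorm (integrable_const _)]
      simp [hpi.le, hI]
    rw [← this]
    exact abs_integral_le_integral_abs
  have hm1 : 2 * Real.pi * |m - 1| ≤ J + (2 * Real.pi - I) := by
    rw [← abs_of_pos (show (0 : ℝ) < 2 * Real.pi by linarith), ← abs_mul,
      abs_of_pos (show (0 : ℝ) < 2 * Real.pi by linarith)]
    rw [abs_le] at hIm ⊢
    constructor <;> linarith [hIm.1, hIm.2]
  refine ⟨hIle, ?_⟩
  calc (∫ s in Ioc 0 (2 * Real.pi), |‖x s‖ - 1|)
      ≤ ∫ s in Ioc 0 (2 * Real.pi), (|‖x s‖ - m| + |m - 1|) := by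
        refine integral_mono (hnorm.sub (integrable_const _)).abs
          (hsub.abs.add (integrable_const _)) fun s => abs_sub_le _ _ _
    _ = J + 2 * Real.pi * |m - 1| := by
        rw [integral_add hsub.abs (integrable_const _)]
        simp [hpi.le, hJ]
    _ ≤ _ := by linarith

/-! ### Analytic functions on circles -/

theorem norm_ofReal_mul_exp {r : ℝ} (hr : 0 ≤ r) (t : ℝ) :
    ‖(r : ℂ) * Complex.exp ((t : ℂ) * Complex.I)‖ = r := by
  rw [norm_mul, Complex.norm_exp_ofReal_mul_I, mul_one, Complex.norm_real, Real.norm_of_nonneg hr]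

theorem continuous_circle {F : ℂ → ℂ} (hF : DifferentiableOn ℂ F (Metric.ball 0 1)) {r : ℝ}
    (hr : r ∈ Ico (0 : ℝ) 1) :
    Continuous fun t : ℝ => F ((r : ℂ) * Complex.exp ((t : ℂ) * Complex.I)) :=
  hF.continuousOn.comp_continuous (by fun_prop) fun t => by
    rw [mem_ball_zero_iff, norm_ofReal_mul_exp hr.1]; exact hr.2

theorem exists_norm_circle_le {F : ℂ → ℂ} (hF : DifferentiableOn ℂ F (Metric.ball 0 1)) {r : ℝ}
    (hr : r ∈ Ico (0 : ℝ) 1) :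
    ∃ B : ℝ, ∀ t : ℝ, ‖F ((r : ℂ) * Complex.exp ((t : ℂ) * Complex.I))‖ ≤ B := by
  obtain ⟨B, hB⟩ := (isCompact_closedBall (0 : ℂ) r).exists_bound_of_continuousOn
    (hF.continuousOn.mono (Metric.closedBall_subset_ball hr.2))
  exact ⟨B, fun t => hB _ (by rw [mem_closedBall_zero_iff, norm_ofReal_mul_exp hr.1])⟩

/-- The Cauchy integral formula bounds the values inside a circle by the `L¹` norm on it. -/
theorem norm_le_integral_circle {F : ℂ → ℂ} (hF : DifferentiableOn ℂ F (Metric.ball 0 1))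
    {z : ℂ} {r : ℝ} (hz : ‖z‖ < r) (hr : r < 1) :
    2 * Real.pi * (r - ‖z‖) * ‖F z‖ ≤
      ∫ t in Ioc 0 (2 * Real.pi), ‖F ((r : ℂ) * Complex.exp ((t : ℂ) * Complex.I))‖ := by
  have hr0 : 0 < r := (norm_nonneg z).trans_lt hz
  have hd : 0 < r - ‖z‖ := sub_pos.2 hz
  have hc := (hF.mono (Metric.closedBall_subset_ball hr)).circleIntegral_sub_inv_smul
    (mem_ball_zero_iff.2 hz)
  have hcont := (continuous_circle hF ⟨hr0.le, hr⟩).norm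
  have hb : ‖∮ w in C(0, r), (w - z)⁻¹ • F w‖ ≤
      ∫ t in 0..(2 * Real.pi),
        (r - ‖z‖)⁻¹ * ‖F ((r : ℂ) * Complex.exp ((t : ℂ) * Complex.I))‖ := by
    refine intervalIntegral.norm_integral_le_of_norm_le Real.two_pi_pos.le
      (ae_of_all _ fun t _ => ?_) ((hcont.const_mul _).intervalIntegrable _ _)
    have hn := norm_ofReal_mul_exp hr0.le t
    have hlow : r - ‖z‖ ≤ ‖(r : ℂ) * Complex.exp ((t : ℂ) * Complex.I) - z‖ := by
      have := norm_sub_norm_le ((r : ℂ) * Complex.exp ((t : ℂ) * Complex.I)) z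
      rwa [hn] at this
    simp only [deriv_circleMap, circleMap, zero_add, norm_smul, norm_mul, norm_inv, Complex.norm_I,
      mul_one, Complex.norm_exp_ofReal_mul_I, Complex.norm_real, Real.norm_of_nonneg hr0.le]
    have h1 : ‖(r : ℂ) * Complex.exp ((t : ℂ) * Complex.I) - z‖⁻¹ ≤ (r - ‖z‖)⁻¹ :=
      inv_anti₀ hd hlow
    calc _ ≤ 1 * ((r - ‖z‖)⁻¹ * ‖F ((r : ℂ) * Complex.exp ((t : ℂ) * Complex.I))‖) := by
          gcongr
      _ = _ := one_mul _
  rw [hc, intervalIntegral.integral_const_mul, norm_smul,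
    intervalIntegral.integral_of_le Real.two_pi_pos.le] at hb
  have h2 : ‖(2 * (Real.pi : ℂ) * Complex.I)‖ = 2 * Real.pi := by
    simp [Real.pi_pos.le]
  rw [h2, inv_mul_eq_div, le_div_iff₀ hd] at hb
  linarith

theorem discExtend_coe (f : 𝔻 → ℂ) (z : 𝔻) : discExtend f (z : ℂ) = f z := by
  have h : ‖(z : ℂ)‖ < 1 := z.norm_lt_one
  rw [discExtend, dif_pos h]
  rfl

theorem exists_norm_discExtend_le {f : 𝔻 → ℂ} (hb : ∃ C : ℝ, ∀ z : 𝔻, ‖f z‖ ≤ C) :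
    ∃ C : ℝ, ∀ z : ℂ, ‖discExtend f z‖ ≤ C := by
  obtain ⟨C, hC⟩ := hb
  refine ⟨C, fun z => ?_⟩
  unfold discExtend
  split_ifs with h
  · exact hC _
  · simpa using (norm_nonneg _).trans (hC 0)

/-! ### Inner functions -/

/-- Radii lie in every approach region of aperture `M > 1`; the proof uses `M = 2`. -/
theorem HasNontangentialLimit.tendsto_radial {f : 𝔻 → ℂ} {t : ℝ} {w : ℂ}
    (h : HasNontangentialLimit f (Complex.exp ((t : ℂ) * Complex.I)) w) :
    Tendsto (fun r : ℝ => discExtend f ((r : ℂ) * Complex.exp ((t : ℂ) * Complex.I)))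
      (𝓝[<] 1) (𝓝 w) := by
  refine (h 2).comp (tendsto_nhdsWithin_iff.2 ⟨?_, ?_⟩)
  · have : Continuous fun r : ℝ => (r : ℂ) * Complex.exp ((t : ℂ) * Complex.I) := by fun_prop
    have := this.tendsto 1
    simp only [Complex.ofReal_one, one_mul] at this
    exact this.mono_left nhdsWithin_le_nhds
  · filter_upwards [Ioo_mem_nhdsLT (show (0 : ℝ) < 1 by norm_num)] with r hr
    have e : (r : ℂ) * Complex.exp ((t : ℂ) * Complex.I) - Complex.exp ((t : ℂ) * Complex.I) =
        ((r - 1 : ℝ) : ℂ) * Complex.exp ((t : ℂ) * Complex.I) := by push_cast; ring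
    refine ⟨?_, ?_⟩
    · rw [norm_ofReal_mul_exp hr.1.le]; exact hr.2
    · rw [e, norm_mul, Complex.norm_exp_ofReal_mul_I, mul_one, Complex.norm_real,
        norm_ofReal_mul_exp hr.1.le, Real.norm_of_nonpos (by linarith [hr.2])]
      linarith [hr.2]

/-- Dominated convergence along radii. All powers are needed for the bound `‖f‖ ≤ 1`, the first one
for the convergence of the means of `|f|`. -/
theorem IsInnerFunction.tendsto_integral_pow {f : 𝔻 → ℂ} (hf : IsInnerFunction f) (n : ℕ) :
    Tendsto (fun r : ℝ => ∫ t in Ioc 0 (2 * Real.pi),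
      ‖discExtend f ((r : ℂ) * Complex.exp ((t : ℂ) * Complex.I))‖ ^ n) (𝓝[<] 1)
      (𝓝 (2 * Real.pi)) := by
  obtain ⟨hd, hb, hlim⟩ := hf
  obtain ⟨C, hC⟩ := exists_norm_discExtend_le hb
  have h1 : (∫ t in Ioc (0 : ℝ) (2 * Real.pi), (1 : ℝ)) = 2 * Real.pi := by
    simp [Real.pi_pos.le]
  rw [show 𝓝 (2 * Real.pi) = 𝓝 (∫ t in Ioc (0 : ℝ) (2 * Real.pi), (1 : ℝ)) by rw [h1]]
  refine tendsto_integral_filter_of_dominated_convergence (fun _ => C ^ n) ?_ ?_ ?_ ?_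
  · filter_upwards [Ioo_mem_nhdsLT (show (0 : ℝ) < 1 by norm_num)] with r hr
    exact ((continuous_circle hd ⟨hr.1.le, hr.2⟩).norm.pow n).aestronglyMeasurable
  · refine Eventually.of_forall fun r => ae_of_all _ fun t => ?_
    rw [Real.norm_of_nonneg (by positivity)]
    exact pow_le_pow_left₀ (norm_nonneg _) (hC _) n
  · exact integrable_const _
  · filter_upwards [ae_restrict_of_ae_restrict_of_subset Ioc_subset_Icc_self hlim]
      with t ⟨w, hw, hw1⟩
    have := (hw.tendsto_radial.norm.pow n)
    rwa [hw1, one_pow] at this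

/-- The maximum principle for inner functions: Cauchy's formula for the powers `f ^ n` bounds
`‖f z‖ ^ n` independently of `n`. -/
theorem IsInnerFunction.norm_discExtend_le_one {f : 𝔻 → ℂ} (hf : IsInnerFunction f) (z : ℂ) :
    ‖discExtend f z‖ ≤ 1 := by
  by_cases hz : ‖z‖ < 1
  swap
  · simp [discExtend, hz]
  have hpi := Real.two_pi_pos
  have key : ∀ n : ℕ, (1 - ‖z‖) * ‖discExtend f z‖ ^ n ≤ 1 := fun n => by
    have hl : Tendsto (fun r : ℝ => 2 * Real.pi * (r - ‖z‖) * ‖discExtend f z‖ ^ n) (𝓝[<] 1)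
        (𝓝 (2 * Real.pi * (1 - ‖z‖) * ‖discExtend f z‖ ^ n)) := by
      have : Continuous fun r : ℝ => 2 * Real.pi * (r - ‖z‖) * ‖discExtend f z‖ ^ n := by fun_prop
      exact (this.tendsto 1).mono_left nhdsWithin_le_nhds
    have := le_of_tendsto_of_tendsto hl (hf.tendsto_integral_pow n) (by
      filter_upwards [Ioo_mem_nhdsLT hz] with r hr
      simpa [norm_pow] using norm_le_integral_circle (hf.1.pow n) hr.1 hr.2)
    rw [mul_assoc] at this
    exact le_of_mul_le_mul_left (by linarith) hpi
  by_contra! hgt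
  have ht : Tendsto (fun n : ℕ => (1 - ‖z‖) * ‖discExtend f z‖ ^ n) atTop atTop :=
    (tendsto_pow_atTop_atTop_of_one_lt hgt).const_mul_atTop (sub_pos.2 hz)
  obtain ⟨n, hn⟩ := (ht.eventually_gt_atTop 1).exists
  exact (key n).not_gt hn

/-! ### Extreme points -/

/-- Strict convexity of the disc, in a form that can be integrated: two numbers of modulus near
`1` with a convex combination of modulus near `1` are near each other. -/
theorem norm_sub_le_of_convexCombination {a b ε : ℝ} (ha : 0 < a) (hb : 0 < b) (hab : a + b = 1)
    (hε : 0 < ε) {u v : ℂ} (hw : ‖(a : ℂ) * u + (b : ℂ) * v‖ ≤ 1) :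
    ‖u - v‖ ≤ ε + (3 / (a * b * ε) + 3) *
      (|‖u‖ - 1| + |‖v‖ - 1| + (1 - ‖(a : ℂ) * u + (b : ℂ) * v‖)) := by
  set w := (a : ℂ) * u + (b : ℂ) * v with hwdef
  have hid : a * b * ‖u - v‖ ^ 2 = a * ‖u‖ ^ 2 + b * ‖v‖ ^ 2 - ‖w‖ ^ 2 := by
    simp only [hwdef, Complex.sq_norm, Complex.normSq_apply, Complex.add_re, Complex.add_im,
      Complex.sub_re, Complex.sub_im, Complex.re_ofReal_mul, Complex.im_ofReal_mul]
    obtain rfl : b = 1 - a := by linarith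
    ring
  set D := |‖u‖ - 1| + |‖v‖ - 1| + (1 - ‖w‖) with hD
  have hu := le_abs_self (‖u‖ - 1)
  have hv := le_abs_self (‖v‖ - 1)
  have hu0 := abs_nonneg (‖u‖ - 1)
  have hv0 := abs_nonneg (‖v‖ - 1)
  have hD0 : 0 ≤ D := by linarith
  have habε : 0 < a * b * ε := by positivity
  have hK : 0 ≤ 3 / (a * b * ε) * D := by positivity
  -- for small moduli `hid` gives `a b ‖u - v‖ ^ 2 ≤ 3 D`; otherwise `D ≥ 1` and the triangle
  -- inequality suffices
  by_cases h2 : ‖u‖ ≤ 2 ∧ ‖v‖ ≤ 2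
  · have hsq : ∀ s : ℝ, 0 ≤ s → s ≤ 2 → s ^ 2 - 1 ≤ 3 * |s - 1| := fun s hs0 hs2 => by
      rcases abs_cases (s - 1) with ⟨h, _⟩ | ⟨h, _⟩ <;> rw [h] <;> nlinarith
    have h1 := mul_le_mul_of_nonneg_left (hsq _ (norm_nonneg u) h2.1) ha.le
    have h1' := mul_le_mul_of_nonneg_left (hsq _ (norm_nonneg v) h2.2) hb.le
    have ha1 : a * (3 * |‖u‖ - 1|) ≤ 1 * (3 * |‖u‖ - 1|) := by gcongr; linarith
    have hb1 : b * (3 * |‖v‖ - 1|) ≤ 1 * (3 * |‖v‖ - 1|) := by gcongr; linarith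
    have hle : a * b * ‖u - v‖ ^ 2 ≤ 3 * D := by
      rw [hid, hD]
      nlinarith [norm_nonneg w]
    rcases le_total ‖u - v‖ ε with h | h
    · linarith
    · have : ‖u - v‖ ≤ 3 / (a * b * ε) * D := by
        rw [div_mul_eq_mul_div, le_div_iff₀ habε]
        refine le_trans ?_ hle
        have := mul_le_mul_of_nonneg_left h (mul_nonneg (mul_pos ha hb).le (norm_nonneg (u - v)))
        linarith
      linarith
  · have h1 : 1 ≤ D := by
      by_contra! hlt
      exact h2 ⟨by linarith, by linarith⟩
    have := norm_sub_le u v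
    linarith

/-- If `|u|` and `|v|` are close to `1` in `L¹` in terms of their defects `2π - ∫ |u|` and
`2π - ∫ |v|`, then `u` and `v` are close in `L¹` in terms of the defect of `a u + b v`. -/
theorem integral_norm_sub_le {a b ε K : ℝ} (ha : 0 < a) (hb : 0 < b) (hab : a + b = 1)
    (hε : 0 < ε) (hK : 0 ≤ K) {u v : ℝ → ℂ} (hu : Continuous u) (hv : Continuous v)
    (hw : ∀ t, ‖(a : ℂ) * u t + (b : ℂ) * v t‖ ≤ 1)
    (hu1 : (∫ t in Ioc 0 (2 * Real.pi), ‖u t‖) ≤ 2 * Real.pi ∧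
      (∫ t in Ioc 0 (2 * Real.pi), |‖u t‖ - 1|) ≤
        K * (2 * Real.pi - ∫ t in Ioc 0 (2 * Real.pi), ‖u t‖))
    (hv1 : (∫ t in Ioc 0 (2 * Real.pi), ‖v t‖) ≤ 2 * Real.pi ∧
      (∫ t in Ioc 0 (2 * Real.pi), |‖v t‖ - 1|) ≤
        K * (2 * Real.pi - ∫ t in Ioc 0 (2 * Real.pi), ‖v t‖)) :
    (∫ t in Ioc 0 (2 * Real.pi), ‖u t - v t‖) ≤ 2 * Real.pi * ε +
      (3 / (a * b * ε) + 3) * (K / a + K / b + 1) *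
        (2 * Real.pi - ∫ t in Ioc 0 (2 * Real.pi), ‖(a : ℂ) * u t + (b : ℂ) * v t‖) := by
  have hi : ∀ {y : ℝ → ℝ}, Continuous y → Integrable y (volume.restrict (Ioc 0 (2 * Real.pi))) :=
    fun hy => hy.integrableOn_Icc.mono_set Ioc_subset_Icc_self
  have hpi : 0 ≤ 2 * Real.pi := Real.two_pi_pos.le
  have hiu := hi hu.norm
  have hiv := hi hv.norm
  have hiu1 : Integrable (fun t => |‖u t‖ - 1|) (volume.restrict (Ioc 0 (2 * Real.pi))) :=
    hi (by fun_prop)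
  have hiv1 : Integrable (fun t => |‖v t‖ - 1|) (volume.restrict (Ioc 0 (2 * Real.pi))) :=
    hi (by fun_prop)
  have hiw : Integrable (fun t => ‖(a : ℂ) * u t + (b : ℂ) * v t‖)
      (volume.restrict (Ioc 0 (2 * Real.pi))) := hi (by fun_prop)
  have hiw1 : Integrable (fun t => 1 - ‖(a : ℂ) * u t + (b : ℂ) * v t‖)
      (volume.restrict (Ioc 0 (2 * Real.pi))) := hi (by fun_prop)
  have hiuv : Integrable (fun t => |‖u t‖ - 1| + |‖v t‖ - 1|)
      (volume.restrict (Ioc 0 (2 * Real.pi))) := hi (by fun_prop)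
  have hisum : Integrable (fun t => |‖u t‖ - 1| + |‖v t‖ - 1| +
      (1 - ‖(a : ℂ) * u t + (b : ℂ) * v t‖)) (volume.restrict (Ioc 0 (2 * Real.pi))) :=
    hi (by fun_prop)
  -- the mean of `|a u + b v|` is at most the combination of the means, so both of these are
  -- close to `1` when it is
  have hW : (∫ t in Ioc 0 (2 * Real.pi), ‖(a : ℂ) * u t + (b : ℂ) * v t‖) ≤
      a * (∫ t in Ioc 0 (2 * Real.pi), ‖u t‖) + b * ∫ t in Ioc 0 (2 * Real.pi), ‖v t‖ := by
    rw [← integral_const_mul, ← integral_const_mul,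
      ← integral_add (hiu.const_mul a) (hiv.const_mul b)]
    refine integral_mono hiw ((hiu.const_mul a).add (hiv.const_mul b)) fun t => ?_
    refine (norm_add_le _ _).trans (le_of_eq ?_)
    simp [abs_of_pos ha, abs_of_pos hb]
  have hmain : (∫ t in Ioc 0 (2 * Real.pi), ‖u t - v t‖) ≤ ∫ t in Ioc 0 (2 * Real.pi),
      (ε + (3 / (a * b * ε) + 3) * (|‖u t‖ - 1| + |‖v t‖ - 1| +
        (1 - ‖(a : ℂ) * u t + (b : ℂ) * v t‖))) :=
    integral_mono (hi (by fun_prop)) ((integrable_const _).add (hisum.const_mul _)) fun t =>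
      norm_sub_le_of_convexCombination ha hb hab hε (hw t)
  have h1 : (∫ t in Ioc (0 : ℝ) (2 * Real.pi), (1 - ‖(a : ℂ) * u t + (b : ℂ) * v t‖)) =
      2 * Real.pi - ∫ t in Ioc 0 (2 * Real.pi), ‖(a : ℂ) * u t + (b : ℂ) * v t‖ := by
    rw [integral_sub (integrable_const _) hiw]
    simp [Real.pi_pos.le]
  have h2 : (∫ _ in Ioc (0 : ℝ) (2 * Real.pi), ε) = 2 * Real.pi * ε := by
    simp [Real.pi_pos.le]
  rw [integral_add (integrable_const _) (hisum.const_mul _), integral_const_mul,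
    integral_add hiuv hiw1, integral_add hiu1 hiv1, h1, h2] at hmain
  refine hmain.trans ?_
  rw [mul_assoc (3 / (a * b * ε) + 3)]
  gcongr
  set U := ∫ t in Ioc 0 (2 * Real.pi), ‖u t‖
  set V := ∫ t in Ioc 0 (2 * Real.pi), ‖v t‖
  set W := ∫ t in Ioc 0 (2 * Real.pi), ‖(a : ℂ) * u t + (b : ℂ) * v t‖
  have hU : 2 * Real.pi - U ≤ (2 * Real.pi - W) / a := by
    rw [le_div_iff₀ ha]
    nlinarith [hv1.1]
  have hV : 2 * Real.pi - V ≤ (2 * Real.pi - W) / b := by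
    rw [le_div_iff₀ hb]
    nlinarith [hu1.1]
  have hU' := hu1.2.trans (mul_le_mul_of_nonneg_left hU hK)
  have hV' := hv1.2.trans (mul_le_mul_of_nonneg_left hV hK)
  calc _ ≤ K * ((2 * Real.pi - W) / a) + K * ((2 * Real.pi - W) / b) + (2 * Real.pi - W) := by
        gcongr
    _ = _ := by ring

theorem discExtend_convexCombination (g h : 𝔻 → ℂ) (a b : ℝ) (z : ℂ) :
    discExtend (a • g + b • h) z = (a : ℂ) * discExtend g z + (b : ℂ) * discExtend h z := by
  unfold discExtend
  split_ifs <;> simp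

theorem mainTheorem3 (φ : ℝ → ℝ)
    (hmono : StrictMonoOn φ (Set.Icc 0 (2 * Real.pi)))
    (hconc : ConcaveOn ℝ (Set.Icc 0 (2 * Real.pi)) φ)
    (hcont : ContinuousOn φ (Set.Icc 0 (2 * Real.pi)))
    (hzero : φ 0 = 0) (hone : φ (2 * Real.pi) = 1)
    (hnonlin : ¬ ∃ c : ℝ, ∀ t ∈ Set.Icc (0 : ℝ) (2 * Real.pi), φ t = c * t)
    (f : Complex.UnitDisc → ℂ) (hf : IsInnerFunction f) :
    f ∈ Set.extremePoints ℝ (hardyLorentzBall φ hmono.monotoneOn hcont) := by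
  have hpi := Real.two_pi_pos
  have hc := half_lt_of_concaveOn_of_not_linear hconc hzero hone hnonlin
  have hnorm : hardyLorentzNorm φ hmono.monotoneOn hcont f ≤ 1 :=
    iSup₂_le fun r _ => lorentzNorm_le_one hmono.monotoneOn hcont hzero hone fun t =>
      hf.norm_discExtend_le_one _
  refine mem_extremePoints_iff_left.2
    ⟨⟨⟨hf.1, hnorm.trans_lt ENNReal.one_lt_top⟩, hnorm⟩, ?_⟩
  rintro g ⟨⟨hg, -⟩, hg1⟩ h ⟨⟨hh, -⟩, hh1⟩ ⟨a, b, ha, hb, hab, rfl⟩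
  suffices hgh : g = h by
    subst hgh
    rw [← add_smul, hab, one_smul]
  set f := a • g + b • h with hfdef
  set K := 1 / (φ Real.pi - 1 / 2) + 1 with hK
  have hK0 : 0 < K := by
    have : 0 < 1 / (φ Real.pi - 1 / 2) := one_div_pos.2 (by linarith)
    linarith
  -- for each `ε`, the `L¹` norm of `g - h` on a circle is at most `2π ε` plus a multiple of the
  -- defect `2π - ∫ |f_r|`, which tends to `0`
  have hcirc : ∀ ε : ℝ, 0 < ε → ∃ M : ℝ, ∀ r ∈ Ico (0 : ℝ) 1,
      (∫ t in Ioc 0 (2 * Real.pi),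
        ‖discExtend g ((r : ℂ) * Complex.exp ((t : ℂ) * Complex.I)) -
          discExtend h ((r : ℂ) * Complex.exp ((t : ℂ) * Complex.I))‖) ≤
      2 * Real.pi * ε + M * (2 * Real.pi - ∫ t in Ioc 0 (2 * Real.pi),
        ‖discExtend f ((r : ℂ) * Complex.exp ((t : ℂ) * Complex.I))‖) := by
    intro ε hε
    refine ⟨(3 / (a * b * ε) + 3) * (K / a + K / b + 1), fun r hr => ?_⟩
    have hgc := continuous_circle hg hr
    have hhc := continuous_circle hh hr
    obtain ⟨B, hB⟩ := exists_norm_circle_le hg hr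
    obtain ⟨B', hB'⟩ := exists_norm_circle_le hh hr
    have hgr := integral_norm_le_of_lorentzNorm_le_one hmono.monotoneOn hconc hcont hzero hone hc
      hgc hB ((le_iSup₂ (f := fun (r : ℝ) (_ : r ∈ Ico (0 : ℝ) 1) =>
        lorentzNorm φ hmono.monotoneOn hcont
          (fun t => discExtend g ((r : ℂ) * Complex.exp ((t : ℂ) * Complex.I)))) r hr).trans hg1)
    have hhr := integral_norm_le_of_lorentzNorm_le_one hmono.monotoneOn hconc hcont hzero hone hc
      hhc hB' ((le_iSup₂ (f := fun (r : ℝ) (_ : r ∈ Ico (0 : ℝ) 1) =>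
        lorentzNorm φ hmono.monotoneOn hcont
          (fun t => discExtend h ((r : ℂ) * Complex.exp ((t : ℂ) * Complex.I)))) r hr).trans hh1)
    have hfeq : ∀ t : ℝ, discExtend f ((r : ℂ) * Complex.exp ((t : ℂ) * Complex.I)) =
        (a : ℂ) * discExtend g ((r : ℂ) * Complex.exp ((t : ℂ) * Complex.I)) +
        (b : ℂ) * discExtend h ((r : ℂ) * Complex.exp ((t : ℂ) * Complex.I)) :=
      fun t => discExtend_convexCombination g h a b _
    have := integral_norm_sub_le ha hb hab hε hK0.le hgc hhc
      (fun t => by rw [← hfeq]; exact hf.norm_discExtend_le_one _) hgr hhr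
    simpa only [← hfeq] using this
  have hdiff : ∀ z : 𝔻, ‖g z - h z‖ ≤ 0 := fun z => by
    have hz : ‖(z : ℂ)‖ < 1 := z.norm_lt_one
    have hd : 0 < 1 - ‖(z : ℂ)‖ := sub_pos.2 hz
    refine le_of_forall_pos_le_add fun ε hε => ?_
    obtain ⟨M, hM⟩ := hcirc (ε * (1 - ‖(z : ℂ)‖)) (by positivity)
    have hl : Tendsto (fun r : ℝ => 2 * Real.pi * (r - ‖(z : ℂ)‖) * ‖g z - h z‖) (𝓝[<] 1)
        (𝓝 (2 * Real.pi * (1 - ‖(z : ℂ)‖) * ‖g z - h z‖)) := by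
      have : Continuous fun r : ℝ => 2 * Real.pi * (r - ‖(z : ℂ)‖) * ‖g z - h z‖ := by fun_prop
      exact (this.tendsto 1).mono_left nhdsWithin_le_nhds
    have hr := (((hf.tendsto_integral_pow 1).const_sub (2 * Real.pi)).const_mul M).const_add
      (2 * Real.pi * (ε * (1 - ‖(z : ℂ)‖)))
    have := le_of_tendsto_of_tendsto hl hr (by
      filter_upwards [Ioo_mem_nhdsLT hz] with r hr
      have h1 := norm_le_integral_circle (hg.sub hh) hr.1 hr.2
      simp only [Pi.sub_apply, discExtend_coe] at h1
      simpa using h1.trans (hM r ⟨(norm_nonneg _).trans hr.1.le, hr.2⟩))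
    rw [sub_self, mul_zero, add_zero, mul_assoc] at this
    have := le_of_mul_le_mul_left this hpi
    rw [mul_comm ε] at this
    simpa using le_of_mul_le_mul_left this hd
  funext z
  exact sub_eq_zero.1 (norm_le_zero_iff.1 (hdiff z))
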